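/- Let $G=(V,E,w)$ be a connected weighted hypergraph: $V$ is a finite set, $E$ is a family of subsets of $V$ each having at least two elements, $w:E\to(0,\infty)$, and any two vertices are joined by a finite chain of vertices in which consecutive vertices lie in a common $e\in E$. Equip $\mathbb R^V$ with the Euclidean inner product and norm, let $1\le p<\infty$, and put $$\varphi(x)=\frac1p\sum_{e\in E}w(e)\Big(\max_{u,v\in e}(x(u)-x(v))\Big)^p,\qquad x\in\mathbb R^V .$$ Let $\emptyset\ne B\subset V$ be the set of vertices at which the value is prescribed. Let $a:[0,\infty)\to\mathbb R^V$ with $a(t)(v)=0$ for $v\notin B$, put $K_a(t)=\{x\in\mathbb R^V:\ x(v)=a(t)(v)\ \ \forall v\in B\}$, and let $I_{K_a(t)}$ be its indicator function ($0$ on $K_a(t)$, $+\infty$ elsewhere). With $\partial$ denoting the subdifferential of convex functions on $\mathbb R^V$, and for $x_0\in K_a(0)$, a (global) solution of $$x'(t)+\partial\varphi(x(t))+\partial I_{K_a(t)}(x(t))\ni h(t)\quad(t>0),\qquad x(0)=x_0, \tag{P}$$ is a function $x:[0,\infty)\to\mathbb R^V$ with $x\in W^{1,2}(0,T;\mathbb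 R^V)$ for every $T<\infty$ (continuous representative) which satisfies the inclusion for a.e. $t>0$ and the initial condition. (i) Assume $a\in W^{1,2}(0,T;\mathbb R^V)$ for every $T<\infty$, $a\in L^p(0,\infty;\mathbb R^V)$, $a'\in L^1(0,\infty;\mathbb R^V)\cap L^2(0,\infty;\mathbb R^V)$, $h\in L^1(0,\infty;\mathbb R^V)\cap L^2(0,\infty;\mathbb R^V)$, and that the weak derivative $h'$ belongs to $L^1(0,\infty;\mathbb R^V)$. Then the solution $x$ of (P) satisfies $x(t)\to0$ as $t\to\infty$. (ii) There is a constant $\gamma>0$ depending only on $p$ and $G$ such that, if $a=h\equiv0$, the solution of (P) satisfies for all $t\ge0$ $$\|x(t)\|\le\begin{cases}\big(\|x_0\|^{2-p}-\gamma t\big)_+^{1/(2-p)}&\text{if }1\le p<2,\\[1mm] \|x_0\|\,e^{-\gamma t}&\text{if }p=2,\\[1mm] \big(\|x_0\|^{-(p-2)}+\gamma t\big)^{-1/(p-2)}&\text{if }p>2,\end{cases}$$ where $(s)_+=\max\{0,s\}$ and, for $p>2$ and $x_0=0$, the right-hand side is understood as $0$. -/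

import Mathlib

open MeasureTheory Set Filter Topology

noncomputable section

/-- A weighted hypergraph `G = (V, E, w)`: a finite family `E` of hyperedges, each containing at
least two vertices, and a weight `w : E → (0, ∞)`. -/
structure WeightedHypergraph (V : Type*) where
  E : Finset (Finset V)
  two_le_card : ∀ e ∈ E, 2 ≤ e.card
  w : {e // e ∈ E} → ℝ
  w_pos : ∀ e, 0 < w e

namespace WeightedHypergraph

variable {V : Type*}

/-- Any two vertices are joined by a finite chain in which consecutive vertices share a
hyperedge (the chain may have length zero when the two vertices coincide). -/
def Connected (G : WeightedHypergraph V) : Prop :=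
  ∀ u v : V, Relation.ReflTransGen (fun u' v' => ∃ e ∈ G.E, u' ∈ e ∧ v' ∈ e) u v

/-- `f_e(x) = max_{u, v ∈ e} (x(u) - x(v))`. For a hyperedge `e` this is a supremum over a
finite nonempty set. -/
def edgeMax (e : Finset V) (x : EuclideanSpace ℝ V) : ℝ :=
  ⨆ q : {v // v ∈ e} × {v // v ∈ e}, (x q.1 - x q.2)

/-- The energy `φ_{G,p}(x) = (1/p) ∑_{e ∈ E} w(e) f_e(x)^p`. -/
def energy (G : WeightedHypergraph V) (p : ℝ) (x : EuclideanSpace ℝ V) : ℝ :=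
  1 / p * ∑ e : {e // e ∈ G.E}, G.w e * edgeMax e.1 x ^ p

end WeightedHypergraph

/-- The subdifferential of `ψ : H → (-∞, +∞]` at `x`: the set of `η` with
`η · (z - x) ≤ ψ(z) - ψ(x)` for all `z`, written additively so that no difference of infinite
values occurs. For proper `ψ` it is empty wherever `ψ x = ⊤`. -/
def subdiff {H : Type*} [NormedAddCommGroup H] [InnerProductSpace ℝ H]
    (ψ : H → EReal) (x : H) : Set H :=
  {η | ∀ z : H, ψ x + ((inner ℝ η (z - x) : ℝ) : EReal) ≤ ψ z}

open Classical in
/-- The indicator function of a set in the sense of convex analysis. -/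
def convexIndicator {H : Type*} (K : Set H) (x : H) : EReal :=
  if x ∈ K then 0 else ⊤

/-- The constraint set attached to the prescribed vertices `B` and the prescribed
values `c`: coordinates in `B` are fixed, all others are free. -/
def constraintSet {V : Type*} (B : Finset V) (c : EuclideanSpace ℝ V) :
    Set (EuclideanSpace ℝ V) :=
  {x | ∀ v ∈ B, x v = c v}

/-- Absolute continuity on each compact interval `[0, T]`. -/
def LocallyAC {H : Type*} [NormedAddCommGroup H] (g : ℝ → H) : Prop :=
  ∀ T : ℝ, 0 < T → AbsolutelyContinuousOnInterval g 0 T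

/-- `g ∈ W^{1,2}(0, T; H)` for every finite `T`, where `g` is the continuous representative:
`g` is absolutely continuous on `[0, T]` (hence bounded there, and differentiable almost
everywhere when `H` is finite-dimensional) and its derivative is in `L²(0, T; H)`. -/
def MemW12Loc {H : Type*} [NormedAddCommGroup H] [NormedSpace ℝ H] (g : ℝ → H) : Prop :=
  LocallyAC g ∧ ∀ T : ℝ, 0 < T → MemLp (deriv g) 2 (volume.restrict (Ioo 0 T))

/-- `x` is a global solution of
`x'(t) + ∂φ_{G,p}(x(t)) + ∂I_{K_a(t)}(x(t)) ∋ h(t)` for a.e. `t > 0`, `x(0) = x₀`. -/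
structure IsSolution {V : Type*} [Fintype V] (G : WeightedHypergraph V) (p : ℝ) (B : Finset V)
    (a h : ℝ → EuclideanSpace ℝ V) (x₀ : EuclideanSpace ℝ V)
    (x : ℝ → EuclideanSpace ℝ V) : Prop where
  memW12Loc : MemW12Loc x
  initial : x 0 = x₀
  inclusion : ∀ᵐ t ∂(volume.restrict (Ioi (0 : ℝ))),
    ∃ η ∈ subdiff (fun y => ((G.energy p y : ℝ) : EReal)) (x t),
      ∃ ξ ∈ subdiff (convexIndicator (constraintSet B (a t))) (x t),
        deriv x t + η + ξ = h t

/-- The decay profile with initial size `r` and rate `γ`. For `p > 2` and `r = 0` the expression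
`(r^{-(p-2)} + γ t)^{-1/(p-2)}` is read as its limit `0` as `r → 0`. -/
def decayBound (p γ r t : ℝ) : ℝ :=
  if p < 2 then (max 0 (r ^ (2 - p) - γ * t)) ^ (1 / (2 - p))
  else if p = 2 then r * Real.exp (-γ * t)
  else if r = 0 then 0
  else (r ^ (-(p - 2)) + γ * t) ^ (-(1 / (p - 2)))

end

/-! Put y = x - a. Since a(t) lies in the constraint set, it is an admissible competitor in both
subgradient inequalities. The normal-cone term has a favourable sign, so (‖y‖²)' ≤ 2(φ(a) - φ(x)) +
2⟨h - a', y⟩ almost everywhere (`IsSolution.ae_deriv_norm_sq_le`).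

As y vanishes on the nonempty set B and the hypergraph is connected, a Poincaré inequality
(`Connected.exists_norm_rpow_le_energy`) bounds ‖y‖^p by a multiple of φ(y), hence of φ(x) + φ(a).
This leaves a scalar inequality for r = ‖y‖, namely (r²)' ≤ A + g r - c r^p with A and g integrable.
It forces r → 0 (`tendsto_zero_of_deriv_sq_le`), and a → 0 by integrability, so x → 0. For a = h = 0
only (r²)' ≤ -2c r^p remains, and integrating it gives the three decay profiles
(`le_decayBound_of_deriv_sq_le`). -/

/-! ### Local absolute continuity and integration of derivative bounds -/

/-- Composition of an absolutely continuous function with a Lipschitz function. -/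
theorem LipschitzOnWith.comp_absolutelyContinuousOnInterval {X Y : Type*} [PseudoMetricSpace X]
    [PseudoMetricSpace Y] {f : ℝ → X} {g : X → Y} {a b : ℝ} {K : NNReal}
    (hg : LipschitzOnWith K g (f '' uIcc a b)) (hf : AbsolutelyContinuousOnInterval f a b) :
    AbsolutelyContinuousOnInterval (fun t => g (f t)) a b := by
  unfold AbsolutelyContinuousOnInterval at hf ⊢
  have h0 := hf.const_mul (K : ℝ)
  rw [mul_zero] at h0
  refine squeeze_zero' (Eventually.of_forall fun E => Finset.sum_nonneg fun i _ => dist_nonneg)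
    ?_ h0
  refine eventually_inf_principal.2 (Eventually.of_forall fun E hE => ?_)
  rw [Finset.mul_sum]
  refine Finset.sum_le_sum fun i hi => ?_
  exact hg.dist_le_mul _ (mem_image_of_mem _ (hE.1 i hi).1) _ (mem_image_of_mem _ (hE.1 i hi).2)

namespace LocallyAC

theorem comp_lipschitz {H F : Type*} [NormedAddCommGroup H] [NormedAddCommGroup F]
    {x : ℝ → H} {g : H → F} {K : NNReal} (hx : LocallyAC x) (hg : LipschitzWith K g) :
    LocallyAC (fun t => g (x t)) :=
  fun T hT => (hg.lipschitzOnWith).comp_absolutelyContinuousOnInterval (hx T hT)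

theorem sub {H : Type*} [NormedAddCommGroup H] {x y : ℝ → H} (hx : LocallyAC x)
    (hy : LocallyAC y) : LocallyAC (fun t => x t - y t) :=
  fun T hT => (hx T hT).fun_sub (hy T hT)

theorem norm {H : Type*} [NormedAddCommGroup H] {x : ℝ → H} (hx : LocallyAC x) :
    LocallyAC (fun t => ‖x t‖) :=
  hx.comp_lipschitz lipschitzWith_one_norm

theorem sq {u : ℝ → ℝ} (hu : LocallyAC u) : LocallyAC (fun t => u t ^ 2) := by
  intro T hT
  simpa only [pow_two] using (hu T hT).fun_mul (hu T hT)

theorem coord {V : Type*} [Fintype V] {x : ℝ → EuclideanSpace ℝ V} (hx : LocallyAC x) (v : V) :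
    LocallyAC (fun t => x t v) :=
  hx.comp_lipschitz (K := 1) (g := fun z : EuclideanSpace ℝ V => z v) <|
    LipschitzWith.of_dist_le_mul fun y z => by
      simpa [dist_eq_norm] using PiLp.norm_apply_le (y - z) v

theorem absolutelyContinuousOnInterval {H : Type*} [NormedAddCommGroup H] {x : ℝ → H}
    (hx : LocallyAC x) {s t : ℝ} (hs : 0 ≤ s) (hst : s ≤ t) :
    AbsolutelyContinuousOnInterval x s t := by
  refine (hx (t + 1) (by linarith)).mono ?_
  rw [uIcc_of_le hst, uIcc_of_le (by linarith)]
  exact Icc_subset_Icc hs (by linarith)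

theorem continuousOn_Icc {H : Type*} [NormedAddCommGroup H] {x : ℝ → H}
    (hx : LocallyAC x) {t : ℝ} (ht : 0 ≤ t) : ContinuousOn x (Icc 0 t) := by
  simpa [uIcc_of_le ht] using (hx.absolutelyContinuousOnInterval le_rfl ht).continuousOn

theorem ae_differentiableAt_real {u : ℝ → ℝ} (hu : LocallyAC u) :
    ∀ᵐ t ∂(volume.restrict (Ioi (0 : ℝ))), DifferentiableAt ℝ u t := by
  have h : ∀ᵐ t : ℝ, ∀ n : ℕ, t ∈ uIcc (0 : ℝ) (n + 1) → DifferentiableAt ℝ u t :=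
    ae_all_iff.2 fun n => (hu (n + 1) (by positivity)).ae_differentiableAt
  rw [ae_restrict_iff' measurableSet_Ioi]
  filter_upwards [h] with t ht h0
  obtain ⟨n, hn⟩ := exists_nat_ge t
  refine ht n ?_
  rw [uIcc_of_le (by positivity)]
  exact ⟨le_of_lt h0, by linarith⟩

theorem ae_differentiableAt {V : Type*} [Fintype V] {x : ℝ → EuclideanSpace ℝ V}
    (hx : LocallyAC x) : ∀ᵐ t ∂(volume.restrict (Ioi (0 : ℝ))), DifferentiableAt ℝ x t := by
  have h := ae_all_iff.2 fun v => (hx.coord v).ae_differentiableAt_real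
  filter_upwards [h] with t ht
  exact (differentiableAt_euclidean).2 ht

/-- A function whose derivative is a.e. at most `F` grows by at most the integral of `F`. -/
theorem sub_le_integral {u F : ℝ → ℝ} {s t : ℝ} (hst : s ≤ t)
    (hs : 0 ≤ s) (hu : AbsolutelyContinuousOnInterval u s t)
    (hF : IntervalIntegrable F volume s t)
    (h : ∀ᵐ τ ∂(volume.restrict (Ioi (0 : ℝ))), τ ∈ Icc s t → deriv u τ ≤ F τ) :
    u t - u s ≤ ∫ τ in s..t, F τ := by
  rw [← hu.integral_deriv_eq_sub, intervalIntegral.integral_of_le hst,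
    intervalIntegral.integral_of_le hst]
  refine setIntegral_mono_ae_restrict hu.intervalIntegrable_deriv.1 hF.1 ?_
  have h' := ae_mono (Measure.restrict_mono
    (Ioc_subset_Ioi_self.trans (Ioi_subset_Ioi hs) : Ioc s t ⊆ Ioi (0 : ℝ)) le_rfl) h
  filter_upwards [h', ae_restrict_mem measurableSet_Ioc] with τ h1 h2
  exact h1 (Ioc_subset_Icc_self h2)

end LocallyAC

theorem MeasureTheory.IntegrableOn.intervalIntegrable_of_Ioi {F : ℝ → ℝ}
    (hF : IntegrableOn F (Ioi 0)) {s t : ℝ} (hs : 0 ≤ s) (hst : s ≤ t) :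
    IntervalIntegrable F volume s t :=
  (intervalIntegrable_iff_integrableOn_Ioc_of_le hst).2
    (hF.mono_set (Ioc_subset_Ioi_self.trans (Ioi_subset_Ioi hs)))

theorem MeasureTheory.IntegrableOn.intervalIntegral_le_Ioi {F : ℝ → ℝ}
    (hF : IntegrableOn F (Ioi 0)) (h0 : ∀ t, 0 ≤ F t) {s t : ℝ} (hs : 0 ≤ s) (hst : s ≤ t) :
    ∫ τ in s..t, F τ ≤ ∫ τ in Ioi 0, F τ := by
  rw [intervalIntegral.integral_of_le hst]
  exact setIntegral_mono_set hF (Eventually.of_forall h0)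
    (Ioc_subset_Ioi_self.trans (Ioi_subset_Ioi hs)).eventuallyLE

/-! ### Scalar differential inequalities -/

/-- A nonnegative function satisfying `(r²)' ≤ A + g r` with integrable `A`, `g` is bounded. -/
theorem exists_bound_of_deriv_sq_le {r A g : ℝ → ℝ} (hr : LocallyAC r)
    (hA : IntegrableOn A (Ioi 0)) (hA0 : ∀ t, 0 ≤ A t)
    (hg : IntegrableOn g (Ioi 0)) (hg0 : ∀ t, 0 ≤ g t)
    (h : ∀ᵐ t ∂(volume.restrict (Ioi (0 : ℝ))), deriv (fun s => r s ^ 2) t ≤ A t + g t * r t) :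
    ∃ M : ℝ, ∀ t, 0 ≤ t → r t ≤ M := by
  set α := r 0 ^ 2 + ∫ t in Ioi 0, A t with hα
  set β := ∫ t in Ioi 0, g t with hβ
  have hα0 : 0 ≤ α := by
    have : 0 ≤ ∫ t in Ioi 0, A t := integral_nonneg hA0
    positivity
  have hβ0 : 0 ≤ β := integral_nonneg hg0
  refine ⟨1 + α + β, fun T hT => ?_⟩
  -- At a maximum point m of r on [0, T], r may be replaced by S = r m in the linear term.
  -- Integration up to m then gives S² ≤ α + βS, which is impossible for S > 1 + α + β.
  obtain ⟨m, hm, hmax⟩ := (isCompact_Icc (a := (0 : ℝ)) (b := T)).exists_isMaxOn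
    ⟨0, le_rfl, hT⟩ (hr.continuousOn_Icc hT)
  refine (hmax ⟨hT, le_rfl⟩).trans ?_
  by_contra! hlt
  set S := r m with hS
  have hS0 : 0 ≤ S := by linarith
  have key := LocallyAC.sub_le_integral (F := fun t => A t + g t * S) hm.1 le_rfl
    (hr.sq.absolutelyContinuousOnInterval le_rfl hm.1)
    ((hA.intervalIntegrable_of_Ioi le_rfl hm.1).add
      ((hg.intervalIntegrable_of_Ioi le_rfl hm.1).mul_const S)) (by
      filter_upwards [h] with t ht hmem
      have : r t ≤ S := hmax ⟨hmem.1, hmem.2.trans hm.2⟩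
      exact ht.trans (by gcongr; exact hg0 t))
  rw [intervalIntegral.integral_add (hA.intervalIntegrable_of_Ioi le_rfl hm.1)
      ((hg.intervalIntegrable_of_Ioi le_rfl hm.1).mul_const S),
    intervalIntegral.integral_mul_const] at key
  have h1 := hA.intervalIntegral_le_Ioi hA0 le_rfl hm.1
  have h2 := mul_le_mul_of_nonneg_right (hg.intervalIntegral_le_Ioi hg0 le_rfl hm.1) hS0
  have h3 : S ^ 2 ≤ α + β * S := by rw [hα, hβ]; linarith
  nlinarith [mul_nonneg hα0 (by linarith : (0 : ℝ) ≤ S - 1)]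

/-- If `(r²)' ≤ A + g r - c r^p` with integrable `A`, `g` and `c > 0`, then `r` tends to zero. -/
theorem tendsto_zero_of_deriv_sq_le {r A g : ℝ → ℝ} {c p : ℝ} (hc : 0 < c) (hp : 0 ≤ p)
    (hr : LocallyAC r) (hr0 : ∀ t, 0 ≤ r t)
    (hA : IntegrableOn A (Ioi 0)) (hA0 : ∀ t, 0 ≤ A t)
    (hg : IntegrableOn g (Ioi 0)) (hg0 : ∀ t, 0 ≤ g t)
    (h : ∀ᵐ t ∂(volume.restrict (Ioi (0 : ℝ))),
      deriv (fun s => r s ^ 2) t ≤ A t + g t * r t - c * r t ^ p) :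
    Tendsto r atTop (𝓝 0) := by
  obtain ⟨M, hM⟩ := exists_bound_of_deriv_sq_le hr hA hA0 hg hg0 (by
    filter_upwards [h] with t ht
    have := mul_nonneg hc.le (Real.rpow_nonneg (hr0 t) p)
    linarith)
  have hM0 : 0 ≤ M := (hr0 0).trans (hM 0 le_rfl)
  set F : ℝ → ℝ := fun t => A t + g t * M with hF
  have hF0 : ∀ t, 0 ≤ F t := fun t => add_nonneg (hA0 t) (mul_nonneg (hg0 t) hM0)
  have hFi : IntegrableOn F (Ioi 0) := hA.add (hg.mul_const M)
  have hd : ∀ᵐ t ∂(volume.restrict (Ioi (0 : ℝ))),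
      deriv (fun s => r s ^ 2) t ≤ F t - c * r t ^ p := by
    filter_upwards [h, ae_restrict_mem measurableSet_Ioi] with t ht h0
    have := mul_le_mul_of_nonneg_left (hM t (le_of_lt h0)) (hg0 t)
    simp only [hF]
    linarith
  have hac : ∀ {s t : ℝ}, 0 ≤ s → s ≤ t →
      AbsolutelyContinuousOnInterval (fun s => r s ^ 2) s t :=
    fun hs hst => hr.sq.absolutelyContinuousOnInterval hs hst
  -- `r² - ∫ F` is nonincreasing and bounded below
  have hconv : ∃ l, Tendsto (fun t => r t ^ 2) atTop (𝓝 l) := by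
    -- Truncating at 0 makes w antitone on all of ℝ, although r is controlled only on [0, ∞).
    set w : ℝ → ℝ := fun t => r (max t 0) ^ 2 - ∫ τ in (0 : ℝ)..(max t 0), F τ with hw
    have hanti : Antitone w := by
      intro s t hst
      have hs0 : 0 ≤ max s 0 := le_max_right _ _
      have hst' : max s 0 ≤ max t 0 := max_le_max hst le_rfl
      have h1 := LocallyAC.sub_le_integral (F := F) hst' hs0 (hac hs0 hst')
        (hFi.intervalIntegrable_of_Ioi hs0 hst') (by
          filter_upwards [hd] with τ hτ _
          have := mul_nonneg hc.le (Real.rpow_nonneg (hr0 τ) p)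
          linarith)
      have h2 := intervalIntegral.integral_add_adjacent_intervals
        (hFi.intervalIntegrable_of_Ioi le_rfl hs0) (hFi.intervalIntegrable_of_Ioi hs0 hst')
      simp only [hw]
      linarith
    have hbdd : BddBelow (range w) := by
      refine ⟨-∫ τ in Ioi 0, F τ, ?_⟩
      rintro _ ⟨t, rfl⟩
      have := hFi.intervalIntegral_le_Ioi hF0 le_rfl (le_max_right t 0)
      have := sq_nonneg (r (max t 0))
      simp only [hw]
      linarith
    have h1 := tendsto_atTop_ciInf hanti hbdd
    have h2 := intervalIntegral_tendsto_integral_Ioi (0 : ℝ) hFi tendsto_id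
    refine ⟨_, (h1.add h2).congr' ?_⟩
    filter_upwards [eventually_ge_atTop 0] with t ht
    simp [hw, max_eq_left ht]
  obtain ⟨l, hl⟩ := hconv
  have hrl : Tendsto r atTop (𝓝 (√l)) :=
    ((Real.continuous_sqrt.tendsto l).comp hl).congr fun t => by simp [Real.sqrt_sq (hr0 t)]
  rcases (Real.sqrt_nonneg l).eq_or_lt with h0 | hpos
  · rwa [← h0] at hrl
  exfalso
  -- If r had a positive limit √l, then eventually r ≥ √l / 2, and r² would fall at rate δ up to a
  -- finite total gain ∫ F, becoming negative.
  set δ := c * (√l / 2) ^ p with hδ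
  have hδ0 : 0 < δ := by positivity
  obtain ⟨T, hT⟩ := eventually_atTop.1 (hrl.eventually_const_le (half_lt_self hpos))
  set S := max T 0
  have hS0 : 0 ≤ S := le_max_right _ _
  have key : ∀ t, S ≤ t → r t ^ 2 ≤ r S ^ 2 + (∫ τ in Ioi 0, F τ) - δ * (t - S) := by
    intro t ht
    have h1 := LocallyAC.sub_le_integral (F := fun τ => F τ - δ) ht hS0 (hac hS0 ht)
      ((hFi.intervalIntegrable_of_Ioi hS0 ht).sub intervalIntegrable_const) (by
        filter_upwards [hd] with τ hτ hmem
        have h2 : √l / 2 ≤ r τ := hT τ ((le_max_left _ _).trans hmem.1)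
        have h3 : δ ≤ c * r τ ^ p := by
          rw [hδ]; gcongr
        linarith)
    rw [intervalIntegral.integral_sub (hFi.intervalIntegrable_of_Ioi hS0 ht)
      intervalIntegrable_const, intervalIntegral.integral_const, smul_eq_mul] at h1
    have h2 := hFi.intervalIntegral_le_Ioi hF0 hS0 ht
    linarith
  set Q := r S ^ 2 + ∫ τ in Ioi 0, F τ
  have hQ : 0 ≤ Q := add_nonneg (sq_nonneg _) (integral_nonneg hF0)
  have h1 := key (S + (Q + 1) / δ) (by have : 0 ≤ (Q + 1) / δ := by positivity
                                       linarith)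
  have h2 : δ * (S + (Q + 1) / δ - S) = Q + 1 := by field_simp; ring
  have := sq_nonneg (r (S + (Q + 1) / δ))
  linarith

/-- If `(r²)' ≤ -2c r^p`, then a primitive `g` of `s ↦ s^(-p/2)`, evaluated along `r²`,
decreases at least at rate `2c` as long as `r` stays positive. -/
theorem primitive_sub_le_of_deriv_sq_le {r g : ℝ → ℝ} {c p : ℝ} (hc : 0 ≤ c) (hp : 0 ≤ p)
    (hr : LocallyAC r) (hr0 : ∀ t, 0 ≤ r t)
    (h : ∀ᵐ t ∂(volume.restrict (Ioi (0 : ℝ))), deriv (fun s => r s ^ 2) t ≤ -(2 * c) * r t ^ p)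
    (hg : ∀ s, 0 < s → HasDerivAt g (s ^ (-(p / 2))) s) {t : ℝ} (ht : 0 ≤ t) (hrt : 0 < r t) :
    g (r t ^ 2) - g (r 0 ^ 2) ≤ -(2 * c) * t := by
  have hle : ∀ s ∈ Icc 0 t, r t ^ 2 ≤ r s ^ 2 := by
    intro s hs
    have := LocallyAC.sub_le_integral (F := fun _ => 0) hs.2 hs.1
      (hr.sq.absolutelyContinuousOnInterval hs.1 hs.2) intervalIntegrable_const (by
        filter_upwards [h] with τ hτ _
        have := mul_nonneg hc (Real.rpow_nonneg (hr0 τ) p)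
        linarith)
    simp only [intervalIntegral.integral_zero] at this
    linarith
  -- The primitive g may be singular at 0, but r² is nonincreasing and so stays above r(t)² on [0,
  -- t]; there g' = s^(-p/2) is at most its value at r(t)².
  have hlip : LipschitzOnWith ((r t ^ 2) ^ (-(p / 2))).toNNReal g
      ((fun s => r s ^ 2) '' uIcc 0 t) := by
    refine LipschitzOnWith.mono (t := Ici (r t ^ 2)) ?_ ?_
    · refine (convex_Ici _).lipschitzOnWith_of_nnnorm_hasDerivWithin_le
        (fun s hs => (hg s ((pow_pos hrt 2).trans_le hs)).hasDerivWithinAt) fun s hs => ?_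
      have hs0 : 0 < s := (pow_pos hrt 2).trans_le hs
      rw [← NNReal.coe_le_coe, coe_nnnorm, Real.norm_of_nonneg (by positivity),
        Real.coe_toNNReal _ (by positivity)]
      exact Real.rpow_le_rpow_of_nonpos (pow_pos hrt 2) hs (by linarith)
    · rintro _ ⟨s, hs, rfl⟩
      rw [uIcc_of_le ht] at hs
      exact hle s hs
  have hac := hlip.comp_absolutelyContinuousOnInterval
    (hr.sq.absolutelyContinuousOnInterval le_rfl ht)
  have key := LocallyAC.sub_le_integral (F := fun _ => -(2 * c)) ht le_rfl hac
    intervalIntegrable_const (by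
      filter_upwards [h, hr.sq.ae_differentiableAt_real] with τ hτ hd hmem
      have hpos : 0 < r τ ^ 2 := (pow_pos hrt 2).trans_le (hle τ hmem)
      have hrτ : 0 < r τ := (hr0 τ).lt_of_ne fun h0 => by simp [← h0] at hpos
      have e := ((hg _ hpos).comp τ hd.hasDerivAt).deriv
      simp only [Function.comp_def] at e
      rw [e]
      have e2 : (r τ ^ 2) ^ (-(p / 2)) * r τ ^ p = 1 := by
        rw [← Real.rpow_natCast, ← Real.rpow_mul hrτ.le, ← Real.rpow_add hrτ]
        norm_num
        rw [show 2 * (p / 2) = p by ring]; simp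
      calc _ ≤ (r τ ^ 2) ^ (-(p / 2)) * (-(2 * c) * r τ ^ p) := by gcongr
        _ = -(2 * c) * ((r τ ^ 2) ^ (-(p / 2)) * r τ ^ p) := by ring
        _ = _ := by rw [e2, mul_one])
  rw [intervalIntegral.integral_const, smul_eq_mul] at key
  linarith

theorem decayBound_nonneg {p γ r t : ℝ} (hγ : 0 ≤ γ) (hr : 0 ≤ r) (ht : 0 ≤ t) :
    0 ≤ decayBound p γ r t := by
  unfold decayBound
  split_ifs <;> positivity

/-- A nonnegative function satisfying `(r²)' ≤ -2c r^p` obeys the decay profile of exponent `p`. -/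
theorem le_decayBound_of_deriv_sq_le {r : ℝ → ℝ} {c p : ℝ} (hc : 0 < c) (hp : 0 ≤ p)
    (hr : LocallyAC r) (hr0 : ∀ t, 0 ≤ r t)
    (h : ∀ᵐ t ∂(volume.restrict (Ioi (0 : ℝ))), deriv (fun s => r s ^ 2) t ≤ -(2 * c) * r t ^ p)
    {t : ℝ} (ht : 0 ≤ t) :
    r t ≤ decayBound p (if p = 2 then c else c * |2 - p|) (r 0) t := by
  have hγ : 0 ≤ (if p = 2 then c else c * |2 - p|) := by split_ifs <;> positivity
  rcases (hr0 t).eq_or_lt with h0 | hrt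
  · rw [← h0]
    exact decayBound_nonneg hγ (hr0 0) ht
  have hr00 : 0 < r 0 := by
    refine (hr0 0).lt_of_ne fun h00 => ?_
    have := LocallyAC.sub_le_integral (F := fun _ => 0) ht le_rfl
      (hr.sq.absolutelyContinuousOnInterval le_rfl ht) intervalIntegrable_const (by
        filter_upwards [h] with τ hτ _
        have := mul_nonneg hc.le (Real.rpow_nonneg (hr0 τ) p)
        linarith)
    simp only [intervalIntegral.integral_zero, ← h00] at this
    nlinarith
  by_cases hp2 : p = 2
  · subst hp2
    have key := primitive_sub_le_of_deriv_sq_le (g := Real.log) hc.le hp hr hr0 h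
      (fun s hs => by simpa [Real.rpow_neg_one] using Real.hasDerivAt_log hs.ne') ht hrt
    rw [Real.log_pow, Real.log_pow] at key
    have h1 : Real.log (r t) ≤ Real.log (r 0) + -c * t := by push_cast at key; linarith
    have h2 := Real.exp_le_exp.2 h1
    rw [Real.exp_add, Real.exp_log hrt, Real.exp_log hr00] at h2
    simpa [decayBound] using h2
  have hp2' : 2 - p ≠ 0 := sub_ne_zero.2 (Ne.symm hp2)
  -- Along r² this primitive equals 2 r^(2-p) / (2 - p). Clearing the denominator produces the rate
  -- c|2 - p| and reverses the inequality when p > 2.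
  have key := primitive_sub_le_of_deriv_sq_le (g := fun s => s ^ ((2 - p) / 2) / ((2 - p) / 2))
    hc.le hp hr hr0 h (fun s hs => by
      have := (Real.hasDerivAt_rpow_const (p := (2 - p) / 2) (Or.inl hs.ne')).div_const
        ((2 - p) / 2)
      convert! this using 1
      rw [mul_div_cancel_left₀ _ (by simpa using hp2')]
      congr 1
      ring) ht hrt
  have hsq : ∀ s : ℝ, 0 ≤ s → (s ^ 2) ^ ((2 - p) / 2) = s ^ (2 - p) := fun s hs => by
    rw [← Real.rpow_natCast, ← Real.rpow_mul hs]
    congr 1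
    push_cast
    ring
  simp only [hsq _ (hr0 _)] at key
  rw [← sub_div] at key
  rw [if_neg hp2]
  rcases lt_or_gt_of_ne hp2 with hlt | hgt
  · have hpos : 0 < 2 - p := by linarith
    rw [div_le_iff₀ (by linarith)] at key
    rw [decayBound, if_pos hlt, abs_of_pos hpos]
    have h1 : r t ^ (2 - p) ≤ max 0 (r 0 ^ (2 - p) - c * (2 - p) * t) :=
      le_max_of_le_right (by linarith)
    calc r t = (r t ^ (2 - p)) ^ (1 / (2 - p)) := by
          rw [← Real.rpow_mul hrt.le, mul_one_div_cancel hp2', Real.rpow_one]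
      _ ≤ _ := by gcongr
  · have hneg : 2 - p < 0 := by linarith
    rw [div_le_iff_of_neg (by linarith)] at key
    rw [decayBound, if_neg hgt.not_gt, if_neg hp2, if_neg hr00.ne', abs_of_neg hneg, neg_sub]
    have h1 : r 0 ^ (2 - p) + c * (p - 2) * t ≤ r t ^ (2 - p) := by linarith
    have h2 : 0 < r 0 ^ (2 - p) + c * (p - 2) * t := by
      have : 0 ≤ c * (p - 2) * t := by
        have : 0 ≤ p - 2 := by linarith
        positivity
      have := Real.rpow_pos_of_pos hr00 (2 - p)
      linarith
    calc r t = (r t ^ (2 - p)) ^ (1 / (2 - p)) := by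
          rw [← Real.rpow_mul hrt.le, mul_one_div_cancel hp2', Real.rpow_one]
      _ ≤ (r 0 ^ (2 - p) + c * (p - 2) * t) ^ (1 / (2 - p)) :=
          Real.rpow_le_rpow_of_nonpos h2 h1 (one_div_nonpos.2 hneg.le)
      _ = _ := by
          rw [← one_div_neg_eq_neg_one_div, neg_sub, neg_sub]

/-! ### Edge functionals, the energy and the Poincaré inequality -/

namespace WeightedHypergraph

section EdgeMax

variable {V : Type*} (e : Finset V) (x y : EuclideanSpace ℝ V)

theorem sub_le_edgeMax {u v : V} (hu : u ∈ e) (hv : v ∈ e) : x u - x v ≤ edgeMax e x :=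
  le_ciSup (f := fun q : {v // v ∈ e} × {v // v ∈ e} => x q.1 - x q.2)
    (Set.finite_range _).bddAbove (⟨u, hu⟩, ⟨v, hv⟩)

theorem edgeMax_nonneg : 0 ≤ edgeMax e x := by
  rcases e.eq_empty_or_nonempty with rfl | ⟨u, hu⟩
  -- The real supremum over an empty index type is 0 by convention.
  · simp [edgeMax]
  · simpa using sub_le_edgeMax e x hu hu

theorem edgeMax_zero : edgeMax e (0 : EuclideanSpace ℝ V) = 0 := by
  simp [edgeMax]

theorem edgeMax_sub_le : edgeMax e (x - y) ≤ edgeMax e x + edgeMax e y := by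
  refine Real.iSup_le (fun q => ?_) (add_nonneg (edgeMax_nonneg e x) (edgeMax_nonneg e y))
  have h1 := sub_le_edgeMax e x q.1.2 q.2.2
  -- The endpoints are swapped for y, which absorbs the minus sign.
  have h2 := sub_le_edgeMax e y q.2.2 q.1.2
  simp only [PiLp.sub_apply]
  linarith

theorem edgeMax_le_norm [Fintype V] : edgeMax e x ≤ 2 * ‖x‖ := by
  refine Real.iSup_le (fun q => ?_) (by positivity)
  have h1 := PiLp.norm_apply_le x q.1.1
  have h2 := PiLp.norm_apply_le x q.2.1
  have h3 := norm_sub_le (x q.1.1) (x q.2.1)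
  rw [Real.norm_eq_abs (x q.1.1 - x q.2.1)] at h3
  linarith [le_abs_self (x q.1.1 - x q.2.1)]

end EdgeMax

variable {V : Type*} (G : WeightedHypergraph V) {p : ℝ}

theorem energy_nonneg (hp : 0 ≤ p) (x : EuclideanSpace ℝ V) : 0 ≤ G.energy p x := by
  refine mul_nonneg (by positivity) (Finset.sum_nonneg fun e _ => ?_)
  exact mul_nonneg (G.w_pos e).le (Real.rpow_nonneg (edgeMax_nonneg _ _) _)

theorem energy_zero (hp : p ≠ 0) : G.energy p 0 = 0 := by
  simp [energy, edgeMax_zero, Real.zero_rpow hp]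

/-- Each edge functional is even and subadditive, and convexity of s ↦ s^p gives (s + t)^p ≤
2^(p-1)(s^p + t^p). This converts a bound on x - a into one on x and a separately. -/
theorem energy_sub_le (hp : 1 ≤ p) (x y : EuclideanSpace ℝ V) :
    G.energy p (x - y) ≤ 2 ^ (p - 1) * (G.energy p x + G.energy p y) := by
  unfold energy
  have h : ∀ e : {e // e ∈ G.E}, G.w e * edgeMax e.1 (x - y) ^ p ≤
      2 ^ (p - 1) * (G.w e * edgeMax e.1 x ^ p + G.w e * edgeMax e.1 y ^ p) := by
    intro e
    have h1 : edgeMax e.1 (x - y) ^ p ≤ (edgeMax e.1 x + edgeMax e.1 y) ^ p :=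
      Real.rpow_le_rpow (edgeMax_nonneg _ _) (edgeMax_sub_le _ _ _) (by linarith)
    have h2 : (edgeMax e.1 x + edgeMax e.1 y) ^ p ≤
        2 ^ (p - 1) * (edgeMax e.1 x ^ p + edgeMax e.1 y ^ p) := by
      exact_mod_cast NNReal.rpow_add_le_mul_rpow_add_rpow ⟨_, edgeMax_nonneg e.1 x⟩
        ⟨_, edgeMax_nonneg e.1 y⟩ hp
    calc _ ≤ G.w e * (2 ^ (p - 1) * (edgeMax e.1 x ^ p + edgeMax e.1 y ^ p)) :=
          mul_le_mul_of_nonneg_left (h1.trans h2) (G.w_pos e).le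
      _ = _ := by ring
  calc _ ≤ 1 / p * ∑ e : {e // e ∈ G.E},
        2 ^ (p - 1) * (G.w e * edgeMax e.1 x ^ p + G.w e * edgeMax e.1 y ^ p) :=
        mul_le_mul_of_nonneg_left (Finset.sum_le_sum fun e _ => h e) (by positivity)
    _ = _ := by rw [← Finset.mul_sum, Finset.sum_add_distrib]; ring

theorem exists_energy_le [Fintype V] (hp : 0 ≤ p) :
    ∃ C : ℝ, 0 ≤ C ∧ ∀ x : EuclideanSpace ℝ V, G.energy p x ≤ C * ‖x‖ ^ p := by
  refine ⟨1 / p * ∑ e : {e // e ∈ G.E}, G.w e * 2 ^ p,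
    mul_nonneg (by positivity) (Finset.sum_nonneg fun e _ =>
      mul_nonneg (G.w_pos e).le (by positivity)), fun x => ?_⟩
  unfold energy
  rw [mul_assoc, Finset.sum_mul]
  refine mul_le_mul_of_nonneg_left (Finset.sum_le_sum fun e _ => ?_) (by positivity)
  rw [mul_assoc, ← Real.mul_rpow (by norm_num) (norm_nonneg x)]
  exact mul_le_mul_of_nonneg_left
    (Real.rpow_le_rpow (edgeMax_nonneg _ _) (edgeMax_le_norm _ _) hp) (G.w_pos e).le

/-- Telescoping along the chain: each link costs at most one edge functional, so C can be the length
of the chain. -/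
theorem exists_abs_sub_le_sum_edgeMax {u v : V}
    (h : Relation.ReflTransGen (fun u' v' => ∃ e ∈ G.E, u' ∈ e ∧ v' ∈ e) u v) :
    ∃ C : ℝ, 0 ≤ C ∧ ∀ x : EuclideanSpace ℝ V,
      |x u - x v| ≤ C * ∑ e : {e // e ∈ G.E}, edgeMax e.1 x := by
  induction h with
  | refl => exact ⟨0, le_rfl, fun x => by simp⟩
  | @tail b c _ hbc ih =>
    obtain ⟨C, hC, hx⟩ := ih
    obtain ⟨e, he, hb, hc⟩ := hbc
    refine ⟨C + 1, by positivity, fun x => ?_⟩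
    have h1 : edgeMax e x ≤ ∑ e : {e // e ∈ G.E}, edgeMax e.1 x :=
      Finset.single_le_sum (f := fun e : {e // e ∈ G.E} => edgeMax e.1 x)
        (fun e _ => edgeMax_nonneg _ _) (Finset.mem_univ ⟨e, he⟩)
    have h2 : |x b - x c| ≤ edgeMax e x :=
      abs_le.2 ⟨by linarith [sub_le_edgeMax e x hc hb], sub_le_edgeMax e x hb hc⟩
    calc |x u - x c| ≤ |x u - x b| + |x b - x c| := abs_sub_le _ _ _
      _ ≤ _ := by rw [add_one_mul]; exact add_le_add (hx x) (h2.trans h1)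

/-- Each edge functional is controlled by the energy. -/
theorem edgeMax_le_energy_rpow (hp : 1 ≤ p) (e : {e // e ∈ G.E}) (x : EuclideanSpace ℝ V) :
    edgeMax e.1 x ≤ (p / G.w e) ^ (1 / p) * G.energy p x ^ (1 / p) := by
  have hp0 : 0 < p := by linarith
  have hw := G.w_pos e
  have h1 : G.w e * edgeMax e.1 x ^ p ≤ ∑ e : {e // e ∈ G.E}, G.w e * edgeMax e.1 x ^ p :=
    Finset.single_le_sum (f := fun e : {e // e ∈ G.E} => G.w e * edgeMax e.1 x ^ p)
      (fun e _ => mul_nonneg (G.w_pos e).le (Real.rpow_nonneg (edgeMax_nonneg _ _) _))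
      (Finset.mem_univ e)
  have h2 : edgeMax e.1 x ^ p ≤ p / G.w e * G.energy p x := by
    rw [energy, ← mul_assoc, div_mul_div_comm, mul_one, mul_comm (G.w e) p, div_mul_eq_div_div,
      div_self hp0.ne', one_div, ← div_eq_inv_mul, le_div_iff₀ hw, mul_comm]
    exact h1
  rw [← Real.mul_rpow (by positivity) (G.energy_nonneg hp0.le x)]
  calc edgeMax e.1 x = (edgeMax e.1 x ^ p) ^ (1 / p) := by
        rw [← Real.rpow_mul (edgeMax_nonneg _ _), mul_one_div_cancel hp0.ne', Real.rpow_one]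
    _ ≤ _ := Real.rpow_le_rpow (Real.rpow_nonneg (edgeMax_nonneg _ _) _) h2 (by positivity)

/-- Poincaré inequality: on a connected hypergraph the energy controls the norm of any vector
vanishing at some vertex. -/
theorem Connected.exists_norm_rpow_le_energy [Fintype V] {G : WeightedHypergraph V}
    (hG : G.Connected) (hp : 1 ≤ p) :
    ∃ C : ℝ, 0 < C ∧ ∀ (x : EuclideanSpace ℝ V) (v : V), x v = 0 →
      ‖x‖ ^ p ≤ C * G.energy p x := by
  have hp0 : 0 < p := by linarith
  choose C hC0 hC using fun u v : V => G.exists_abs_sub_le_sum_edgeMax (hG u v)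
  set S : ℝ := ∑ e : {e // e ∈ G.E}, (p / G.w e) ^ (1 / p) with hS
  have hS0 : 0 ≤ S := Finset.sum_nonneg fun e _ =>
    Real.rpow_nonneg (div_nonneg hp0.le (G.w_pos e).le) _
  set D : ℝ := ∑ u : V, ∑ v : V, C u v with hD
  have hD0 : 0 ≤ D := Finset.sum_nonneg fun u _ => Finset.sum_nonneg fun v _ => hC0 u v
  -- The summand 1 keeps the constant positive when D * S = 0, as for a single vertex. Summing C
  -- over all pairs makes it independent of the vertex v.
  refine ⟨(D * S + 1) ^ p, by positivity, fun x v hv => ?_⟩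
  have hE := G.energy_nonneg hp0.le x
  set ε := G.energy p x ^ (1 / p) with hε
  have hε0 : 0 ≤ ε := Real.rpow_nonneg hE _
  have h1 : ∑ e : {e // e ∈ G.E}, edgeMax e.1 x ≤ S * ε := by
    rw [hS, Finset.sum_mul]
    exact Finset.sum_le_sum fun e _ => G.edgeMax_le_energy_rpow hp e x
  have h2 : ‖x‖ ≤ ∑ u, |x u| := by
    classical
    have : x = ∑ u, EuclideanSpace.single u (x u) := by
      ext w
      simp
    calc ‖x‖ = ‖∑ u, EuclideanSpace.single u (x u)‖ := by rw [← this]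
      _ ≤ _ := (norm_sum_le _ _).trans (by simp)
  have h3 : ∑ u, |x u| ≤ D * (S * ε) := by
    rw [hD, Finset.sum_mul]
    refine Finset.sum_le_sum fun u _ => ?_
    have h4 := hC u v x
    rw [hv, sub_zero] at h4
    have h5 : C u v ≤ ∑ v, C u v :=
      Finset.single_le_sum (f := fun v => C u v) (fun v _ => hC0 u v) (Finset.mem_univ v)
    exact h4.trans (mul_le_mul h5 h1 (Finset.sum_nonneg fun e _ => edgeMax_nonneg _ _)
      ((hC0 u v).trans h5))
  have h6 : ‖x‖ ≤ (D * S + 1) * ε := by nlinarith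
  calc ‖x‖ ^ p ≤ ((D * S + 1) * ε) ^ p := Real.rpow_le_rpow (norm_nonneg x) h6 hp0.le
    _ = _ := by
      rw [Real.mul_rpow (by positivity) hε0, hε, ← Real.rpow_mul hE,
        one_div_mul_cancel hp0.ne', Real.rpow_one]

end WeightedHypergraph

/-! ### Subgradients and the energy inequality -/

section Subdifferential

variable {H : Type*} [NormedAddCommGroup H] [InnerProductSpace ℝ H]

theorem le_of_mem_subdiff_coe {f : H → ℝ} {x η : H}
    (hη : η ∈ subdiff (fun y => ((f y : ℝ) : EReal)) x) (z : H) :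
    f x + inner ℝ η (z - x) ≤ f z := by
  have h : ((f x : ℝ) : EReal) + ((inner ℝ η (z - x) : ℝ) : EReal) ≤ ((f z : ℝ) : EReal) := hη z
  exact_mod_cast h

theorem mem_of_mem_subdiff_convexIndicator {K : Set H} (hK : K.Nonempty) {x ξ : H}
    (hξ : ξ ∈ subdiff (convexIndicator K) x) : x ∈ K := by
  by_contra hx
  obtain ⟨z, hz⟩ := hK
  have := hξ z
  -- Outside K the indicator is ⊤, so testing against a point of K would give ⊤ ≤ 0.
  simp [convexIndicator, hx, hz] at this

theorem inner_le_of_mem_subdiff_convexIndicator {K : Set H} {x ξ z : H} (hx : x ∈ K)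
    (hz : z ∈ K) (hξ : ξ ∈ subdiff (convexIndicator K) x) : inner ℝ ξ (z - x) ≤ 0 := by
  have := hξ z
  simp only [convexIndicator, hx, hz, if_true, zero_add] at this
  exact_mod_cast this

end Subdifferential

/-- The basic energy inequality for the distance of a solution to the boundary data. -/
theorem IsSolution.ae_deriv_norm_sq_le {V : Type*} [Fintype V] {G : WeightedHypergraph V} {p : ℝ}
    {B : Finset V} {a h : ℝ → EuclideanSpace ℝ V} {x₀ : EuclideanSpace ℝ V}
    {x : ℝ → EuclideanSpace ℝ V} (hx : IsSolution G p B a h x₀ x) (ha : LocallyAC a) :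
    ∀ᵐ t ∂(volume.restrict (Ioi (0 : ℝ))), x t ∈ constraintSet B (a t) ∧
      deriv (fun s => ‖x s - a s‖ ^ 2) t ≤ 2 * (G.energy p (a t) - G.energy p (x t)) +
        2 * inner ℝ (h t - deriv a t) (x t - a t) := by
  filter_upwards [hx.inclusion, hx.memW12Loc.1.ae_differentiableAt, ha.ae_differentiableAt]
    with t ⟨η, hη, ξ, hξ, heq⟩ hdx hda
  have haK : a t ∈ constraintSet B (a t) := fun v _ => rfl
  have hxK := mem_of_mem_subdiff_convexIndicator ⟨_, haK⟩ hξ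
  refine ⟨hxK, ?_⟩
  have h1 := le_of_mem_subdiff_coe hη (a t)
  have h2 : 0 ≤ inner ℝ ξ (x t - a t) := by
    have := inner_le_of_mem_subdiff_convexIndicator hxK haK hξ
    rw [← neg_sub, inner_neg_right] at this
    linarith
  have hd : HasDerivAt (fun s => x s - a s) (deriv x t - deriv a t) t :=
    hdx.hasDerivAt.sub hda.hasDerivAt
  have e1 := hd.norm_sq.deriv
  rw [e1, ← heq]
  rw [← neg_sub, inner_neg_right] at h1
  have e2 : inner ℝ (x t - a t) (deriv x t - deriv a t) =
      inner ℝ (deriv x t - deriv a t) (x t - a t) := real_inner_comm _ _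
  rw [e2, show deriv x t + η + ξ - deriv a t = (deriv x t - deriv a t) + η + ξ by abel,
    inner_add_left, inner_add_left]
  linarith

/-! ### Convergence to zero and decay rates -/

/-- A locally absolutely continuous function in `L^p(0, ∞)` with integrable derivative vanishes
at infinity. -/
theorem LocallyAC.tendsto_zero {V : Type*} [Fintype V] {a : ℝ → EuclideanSpace ℝ V} {p : ℝ}
    (hp : 1 ≤ p) (ha : LocallyAC a) (hd : MemLp (deriv a) 1 (volume.restrict (Ioi 0)))
    (hap : MemLp a (ENNReal.ofReal p) (volume.restrict (Ioi 0))) :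
    Tendsto a atTop (𝓝 0) := by
  have hp0 : 0 < p := by linarith
  have hcoord : ∀ v, ∃ l, Tendsto (fun t => a t v) atTop (𝓝 l) := by
    intro v
    have hi : IntegrableOn (deriv fun t => a t v) (Ioi 0) := by
      have h1 : IntegrableOn (fun t => deriv a t v) (Ioi 0) :=
        (EuclideanSpace.proj v : EuclideanSpace ℝ V →L[ℝ] ℝ).integrable_comp
          (memLp_one_iff_integrable.1 hd)
      refine h1.congr ?_
      filter_upwards [ha.ae_differentiableAt] with t ht
      exact (((EuclideanSpace.proj v : EuclideanSpace ℝ V →L[ℝ] ℝ).hasFDerivAt.comp_hasDerivAt t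
        ht.hasDerivAt).deriv).symm
    have h2 := intervalIntegral_tendsto_integral_Ioi (0 : ℝ) hi tendsto_id
    refine ⟨_, (h2.add_const (a 0 v)).congr' ?_⟩
    filter_upwards [eventually_ge_atTop 0] with t ht
    simp [((ha.coord v).absolutelyContinuousOnInterval le_rfl ht).integral_deriv_eq_sub]
  choose l hl using hcoord
  have hlim : Tendsto a atTop (𝓝 (WithLp.toLp 2 l)) := by
    have := (PiLp.continuous_toLp 2 (fun _ : V => ℝ)).tendsto l |>.comp (tendsto_pi_nhds.2 hl)
    exact this
  have hnorm : Tendsto (fun t => ‖a t‖ ^ p) atTop (𝓝 (‖WithLp.toLp 2 l‖ ^ p)) :=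
    hlim.norm.rpow_const (Or.inr hp0.le)
  have hint : IntegrableOn (fun t => ‖a t‖ ^ p) (Ioi 0) := by
    have := hap.integrable_norm_rpow (by simpa using hp0) ENNReal.ofReal_ne_top
    rwa [ENNReal.toReal_ofReal hp0.le] at this
  -- The integrable derivative provides a limit; a nonzero one would make ‖a‖^p nonintegrable, since
  -- every half-line has infinite measure.
  have h0 := IntegrableAtFilter.eq_zero_of_tendsto (μ := volume)
    ⟨Ioi 0, Ioi_mem_atTop 0, hint⟩ (by
      intro s hs
      obtain ⟨T, hT⟩ := mem_atTop_sets.1 hs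
      exact top_unique (Real.volume_Ici (a := T) ▸ measure_mono hT)) hnorm
  rw [Real.rpow_eq_zero (norm_nonneg _) hp0.ne', norm_eq_zero] at h0
  rwa [h0] at hlim


theorem IsSolution.tendsto_zero {V : Type*} [Fintype V] {G : WeightedHypergraph V}
    (hG : G.Connected) {p : ℝ} (hp : 1 ≤ p) {B : Finset V} (hB : B.Nonempty)
    {a h : ℝ → EuclideanSpace ℝ V} {x₀ : EuclideanSpace ℝ V} {x : ℝ → EuclideanSpace ℝ V}
    (ha : LocallyAC a) (hda : MemLp (deriv a) 1 (volume.restrict (Ioi 0)))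
    (hap : MemLp a (ENNReal.ofReal p) (volume.restrict (Ioi 0)))
    (hh : MemLp h 1 (volume.restrict (Ioi 0))) (hx : IsSolution G p B a h x₀ x) :
    Tendsto x atTop (𝓝 0) := by
  have hp0 : 0 < p := by linarith
  obtain ⟨v, hv⟩ := hB
  obtain ⟨C, hC, hpoincare⟩ := hG.exists_norm_rpow_le_energy hp
  obtain ⟨D, hD, henergy⟩ := G.exists_energy_le hp0.le
  set q : ℝ := 2 ^ (p - 1) with hq
  have hq0 : 0 < q := by positivity
  have hint : IntegrableOn (fun t => ‖a t‖ ^ p) (Ioi 0) := by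
    have := hap.integrable_norm_rpow (by simpa using hp0) ENNReal.ofReal_ne_top
    rwa [ENNReal.toReal_ofReal hp0.le] at this
  have hy : Tendsto (fun t => ‖x t - a t‖) atTop (𝓝 0) := by
    -- The constants come from 2(φ(a) - φ(x)) = 4φ(a) - 2(φ(x) + φ(a)), with φ(a) ≤ D‖a‖^p and ‖x -
    -- a‖^p ≤ C q (φ(x) + φ(a)).
    refine tendsto_zero_of_deriv_sq_le (c := 2 / (C * q)) (p := p)
      (A := fun t => 4 * D * ‖a t‖ ^ p) (g := fun t => 2 * (‖h t‖ + ‖deriv a t‖))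
      (by positivity) hp0.le (hx.memW12Loc.1.sub ha).norm (fun t => norm_nonneg _)
      (hint.const_mul _) (fun t => by positivity)
      (((memLp_one_iff_integrable.1 hh).norm.add
        (memLp_one_iff_integrable.1 hda).norm).const_mul 2) (fun t => by positivity) ?_
    filter_upwards [hx.ae_deriv_norm_sq_le ha] with t ⟨hxK, hle⟩
    refine hle.trans ?_
    have h1 := hpoincare (x t - a t) v (by simp [hxK v hv])
    have h2 := G.energy_sub_le hp (x t) (a t)
    have h3 := henergy (a t)
    have h4 : 2 / (C * q) * ‖x t - a t‖ ^ p ≤ 2 * (G.energy p (x t) + G.energy p (a t)) := by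
      rw [div_mul_eq_mul_div, div_le_iff₀ (by positivity)]
      have := mul_le_mul_of_nonneg_left h2 hC.le
      linarith
    have h5 : inner ℝ (h t - deriv a t) (x t - a t) ≤
        (‖h t‖ + ‖deriv a t‖) * ‖x t - a t‖ :=
      (real_inner_le_norm _ _).trans
        (mul_le_mul_of_nonneg_right (norm_sub_le _ _) (norm_nonneg _))
    linarith
  have := (tendsto_zero_iff_norm_tendsto_zero.2 hy).add (ha.tendsto_zero hp hda hap)
  simpa using this

theorem WeightedHypergraph.Connected.exists_decay_rate {V : Type*} [Fintype V]
    {G : WeightedHypergraph V} (hG : G.Connected) {p : ℝ} (hp : 1 ≤ p) :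
    ∃ γ : ℝ, 0 < γ ∧
      ∀ (B : Finset V) (x₀ : EuclideanSpace ℝ V) (x : ℝ → EuclideanSpace ℝ V),
        B.Nonempty → IsSolution G p B (fun _ => 0) (fun _ => 0) x₀ x →
        ∀ t, 0 ≤ t → ‖x t‖ ≤ decayBound p γ ‖x₀‖ t := by
  have hp0 : 0 < p := by linarith
  obtain ⟨C, hC, hpoincare⟩ := hG.exists_norm_rpow_le_energy hp
  -- The Poincaré constant C serves every vertex, so this rate does not depend on B.
  refine ⟨if p = 2 then 1 / C else 1 / C * |2 - p|, ?_, ?_⟩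
  · split_ifs with h2
    · positivity
    · have : 0 < |2 - p| := abs_pos.2 (sub_ne_zero.2 (Ne.symm h2))
      positivity
  rintro B x₀ x ⟨v, hv⟩ hx t ht
  rw [← hx.initial]
  have h0 : LocallyAC (fun _ : ℝ => (0 : EuclideanSpace ℝ V)) := fun T _ =>
    (LipschitzWith.const (0 : EuclideanSpace ℝ V)).lipschitzOnWith.absolutelyContinuousOnInterval
  refine le_decayBound_of_deriv_sq_le (r := fun t => ‖x t‖) (one_div_pos.2 hC) hp0.le
    hx.memW12Loc.1.norm (fun t => norm_nonneg _) ?_ ht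
  filter_upwards [hx.ae_deriv_norm_sq_le h0] with s ⟨hxK, hle⟩
  simp only [sub_zero, deriv_const, inner_zero_left, mul_zero, add_zero,
    G.energy_zero hp0.ne', zero_sub] at hle
  refine hle.trans ?_
  have h1 := hpoincare (x s) v (by simpa using hxK v hv)
  have h2 : 1 / C * ‖x s‖ ^ p ≤ G.energy p (x s) := by
    rw [one_div_mul_eq_div, div_le_iff₀ hC]
    linarith
  linarith

theorem theorem5p3 {V : Type*} [Fintype V] (G : WeightedHypergraph V) (hG : G.Connected)
    (p : ℝ) (hp : 1 ≤ p) :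
    -- convergence to zero
    (∀ (B : Finset V) (a h : ℝ → EuclideanSpace ℝ V) (x₀ : EuclideanSpace ℝ V)
        (x : ℝ → EuclideanSpace ℝ V),
      B.Nonempty →
      (∀ t, 0 ≤ t → ∀ v, v ∉ B → a t v = 0) →
      MemW12Loc a →
      MemLp (deriv a) 1 (volume.restrict (Ioi 0)) →
      MemLp (deriv a) 2 (volume.restrict (Ioi 0)) →
      MemLp a (ENNReal.ofReal p) (volume.restrict (Ioi 0)) →
      MemLp h 1 (volume.restrict (Ioi 0)) →
      MemLp h 2 (volume.restrict (Ioi 0)) →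
      -- the weak derivative of `h` is integrable on `(0, ∞)`
      (∃ k : ℝ → EuclideanSpace ℝ V, h =ᵐ[volume.restrict (Ioi 0)] k ∧ LocallyAC k ∧
        MemLp (deriv k) 1 (volume.restrict (Ioi 0))) →
      x₀ ∈ constraintSet B (a 0) →
      IsSolution G p B a h x₀ x →
      Tendsto x atTop (𝓝 0)) ∧
    -- decay rates for vanishing data
    (∃ γ : ℝ, 0 < γ ∧
      ∀ (B : Finset V) (x₀ : EuclideanSpace ℝ V) (x : ℝ → EuclideanSpace ℝ V),
        B.Nonempty →
        x₀ ∈ constraintSet B 0 →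
        IsSolution G p B (fun _ => 0) (fun _ => 0) x₀ x →
        ∀ t, 0 ≤ t → ‖x t‖ ≤ decayBound p γ ‖x₀‖ t) := by
  refine ⟨fun B a h x₀ x hB _ ha hda _ hap hh _ _ _ hx =>
    hx.tendsto_zero hG hp hB ha.1 hda hap hh, ?_⟩
  obtain ⟨γ, hγ, hdecay⟩ := hG.exists_decay_rate hp
  exact ⟨γ, hγ, fun B x₀ x hB _ hx => hdecay B x₀ x hB hx⟩
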